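/- **Regenerating codes.** Let $\mathbb F$ be a finite field. A *linear exact-repair $(n,k,d)$ regenerating code with parameters $(\alpha,\beta,F)$* is a linear map that sends a file of $F$ symbols of $\mathbb F$ to an $n$-tuple of vectors of $\alpha$ symbols (the contents of $n$ nodes) such that (data recovery) the file is a linear function of the contents of any $k$ nodes, and (exact repair) for every failed node $f$, each other node $h$ can compute linearly from its own content $\beta$ symbols, depending on $f$ and $h$ only, such that for every set $\mathcal H\not\ni f$ of $d$ helper nodes the content of $f$ is a linear function of the $d\beta$ symbols computed by the nodes of $\mathcal H$. **Cascade codes.** Let $k\le d<n$ and $\mu\in\{1,\dots,k\}$; write $[a:b]=\{a,\dots,b\}$, $\mathrm{ind}_I(x)=|\{y\in I:y\le x\}|$ and $\max\varnothing=-\infty$. An *encoder matrix* is an $n\times d$ matrix $\Psi$ over $\mathbb F$ such that any $d$ rows of $\Psi$ are linearly independent and any $k$ rows of the submatrix formed by its first $k$ columns are linearly independent. The *message matrix* $D$ of mode $m\ge 0$ with signature $\sigma:[1:d]\to\mathbb Z$ has rows $x\in[1:d]$ and columns $I\subseteq[1:d]$, $|I|=m$, and $$D_{x,I}=(-1)^{\sigma(x)}v_{x,I}\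 \text{ if } x\in I,\qquad D_{x,I}=(-1)^{\sigma(x)}w_{x,I\cup\{x\}}\ \text{ if } x\notin I.$$ Here $v_{x,X}$ ($|X|=m$, $x\in X$) and $w_{x,Y}$ ($|Y|=m+1$, $x\in Y$, $x\ne\max Y$) are independent file symbols, except that the symbol in position $(x,I)$ is replaced by $0$ if $x\in[k+1:d]$, $x\le\max I$ and $I\subseteq[k+1:d]$; the parity symbols $w_{\max Y,Y}$ are determined by $\sum_{y\in Y}(-1)^{\mathrm{ind}_Y(y)}w_{y,Y}=0$. The *code segments* form a rooted tree. The root is a message matrix of mode $\mu$ with zero signature. A segment with message matrix $P$ of mode $j$ and signature $\sigma$ has one child for each pair $(x,B)$ with $B\subseteq[k+1:d]$, $|B|<j$, $x\in[k+1:d]$ and $x\le\max B$. The child has its own file symbols, a message matrix $Q$ of mode $j-|B|-1$ and signature $i\mapsto 1+\sigma(i)+\mathrm{ind}_{B\cup\{i\}}(i)$, and it is modified to $Q+\Delta$, where $$\Delta_{i,I}=(-1)^{1+\sigma(i)+\mathrm{ind}_{I\cup\{i\}\cup B}(i)}\,P_{x,I\cup\{i\}\cup B}\quad\text{if } i>\max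 I,\ i\notin B,\ I\cap B=\varnothing,$$ and $\Delta_{i,I}=0$ otherwise. The *super message matrix* $M$ is the concatenation of the root and of all the modified children, and the *cascade code* of mode $\mu$ with encoder matrix $\Psi$ stores the $i$-th row of $\Psi M$ in node $i$. **Theorem 1.** Let $k\le d<n$ and $\mu\in\{1,\dots,k\}$. An encoder matrix exists over every finite field with at least $n$ elements. For every finite field $\mathbb F$ and every encoder matrix $\Psi$ over $\mathbb F$, the cascade code of mode $\mu$ with encoder matrix $\Psi$ is a linear exact-repair $(n,k,d)$ regenerating code with parameters $$\alpha=\sum_{m=0}^{\mu}(d-k)^{\mu-m}\binom km,\qquad \beta=\sum_{m=0}^{\mu}(d-k)^{\mu-m}\binom{k-1}{m-1},\qquad F=\sum_{m=0}^{\mu}k(d-k)^{\mu-m}\binom km-\binom k{\mu+1},$$ where $\binom{k-1}{-1}=0$ and $0^0=1$. In particular data recovery works from any $k$ nodes and exact repair from any $d$ helper nodes. -/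

import Mathlib

namespace Cascade

/-! ### Linear exact-repair regenerating codes -/

/-- Exact repair by linear operations: for every failed node `f`, every other node `h` applies a
linear map `Φ h` to its content, which yields `β` symbols.  From what any `d` helpers send, the
content of `f` is restored by a linear map.  What a helper sends depends on `f` and on the helper,
but not on the other members of the helper set. -/
def ExactRepair {𝔽 ι κ : Type*} [Field 𝔽] {n : ℕ} (d β : ℕ)
    (C : (ι → 𝔽) → Matrix (Fin n) κ 𝔽) : Prop :=
  ∀ f : Fin n, ∃ Φ : Fin n → ((κ → 𝔽) →ₗ[𝔽] (Fin β → 𝔽)),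
    ∀ H : Finset (Fin n), f ∉ H → H.card = d →
      ∃ R : (H → Fin β → 𝔽) →ₗ[𝔽] (κ → 𝔽),
        ∀ s : ι → 𝔽, R (fun h => Φ h (C s h)) = C s f

/-- Data recovery: the whole file is a (linear) function of the contents of any `k` nodes. -/
def DataRecovery {𝔽 ι κ : Type*} [Field 𝔽] {n : ℕ} (k : ℕ)
    (C : (ι → 𝔽) → Matrix (Fin n) κ 𝔽) : Prop :=
  ∀ K : Finset (Fin n), K.card = k →
    ∃ R : (K → κ → 𝔽) →ₗ[𝔽] (ι → 𝔽), ∀ s : ι → 𝔽, R (fun i => C s i) = s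

/-- `C` maps a file `s`, whose symbols are indexed by `ι`, to the matrix whose `i`-th row is the
content of node `i`, with coordinates indexed by `κ`.  It is a linear exact-repair regenerating
code with parameters `(n, k, d)`, node capacity `α`, repair bandwidth `β` (per helper) and file
size `F` (an integer, so that a formula with a subtraction can be plugged in). -/
structure IsLinearExactRepairCode {𝔽 ι κ : Type*} [Field 𝔽] {n : ℕ} (k d α β : ℕ) (F : ℤ)
    (C : (ι → 𝔽) → Matrix (Fin n) κ 𝔽) : Prop where
  finite_file : Finite ι
  finite_content : Finite κ
  file_size : (Nat.card ι : ℤ) = F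
  capacity : Nat.card κ = α
  linear : IsLinearMap 𝔽 C
  recovery : DataRecovery k C
  repair : ExactRepair d β C

/-! ### The parameters -/

/-- The binomial coefficient, which is `0` when the lower index is negative. -/
def binom (l : ℕ) (m : ℤ) : ℕ := if 0 ≤ m then l.choose m.toNat else 0

/-- The node capacity. -/
def alpha (k d μ : ℕ) : ℕ :=
  ∑ m ∈ Finset.range (μ + 1), (d - k) ^ (μ - m) * k.choose m

/-- The repair bandwidth. -/
def beta (k d μ : ℕ) : ℕ :=
  ∑ m ∈ Finset.range (μ + 1), (d - k) ^ (μ - m) * binom (k - 1) ((m : ℤ) - 1)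

/-- The file size. -/
def fileSize (k d μ : ℕ) : ℤ :=
  ∑ m ∈ Finset.range (μ + 1), (k : ℤ) * ((d : ℤ) - (k : ℤ)) ^ (μ - m) * (k.choose m : ℤ)
    - (k.choose (μ + 1) : ℤ)

/-! ### The encoder matrix -/

/-- Any `k` rows of the submatrix formed by the first `k` columns are linearly independent, and so
are any `d` rows of the full matrix. -/
structure IsEncoder {𝔽 : Type*} [Field 𝔽] {n d : ℕ} (k : ℕ) (Ψ : Matrix (Fin n) (Fin d) 𝔽) :
    Prop where
  left : ∀ S : Finset (Fin n), S.card = k →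
    LinearIndependent 𝔽 (fun (i : S) (j : {j : Fin d // j.val < k}) => Ψ i j)
  full : ∀ S : Finset (Fin n), S.card = d → LinearIndependent 𝔽 (fun i : S => Ψ i)

/-! ### Signed determinant codes

The set `{1, …, d}` is modelled by `Fin d`, so that the upper rows `1, …, k` are those `x : Fin d`
with `x < k` and the lower rows `k + 1, …, d` those with `k ≤ x`.  The columns of a message matrix
of mode `m` are labelled by the subsets of `Fin d` with `m` elements.  While a matrix is being built
it is a function of a row and of any finite set; only the columns of the right size are ever
used. -/

/-- The number of elements of `I` not exceeding `x`. -/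
def ind {d : ℕ} (I : Finset (Fin d)) (x : Fin d) : ℕ := (I.filter (fun y => y ≤ x)).card

/-- The entry in row `x` and column `I` is nulled: it lies in a lower row, it is not a parity entry,
that is, `x ≤ max I`, and `I` contains no upper index. -/
abbrev Nulled {d : ℕ} (k : ℕ) (x : Fin d) (I : Finset (Fin d)) : Prop :=
  k ≤ x.val ∧ (∃ b ∈ I, x ≤ b) ∧ ∀ a ∈ I, k ≤ a.val

/-- The file symbols `v_{x, X}` of a segment of mode `m`: `|X| = m`, `x ∈ X`, and the entry
`(x, X)`, which holds the symbol, is not nulled. -/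
abbrev VIdx (k d m : ℕ) : Type :=
  {p : Fin d × Finset (Fin d) // p.2.card = m ∧ p.1 ∈ p.2 ∧ ¬ Nulled k p.1 p.2}

/-- The file symbols `w_{x, Y}` of a segment of mode `m`: `|Y| = m + 1`, `x ∈ Y`, `x ≠ max Y`, and
the entry `(x, Y \ {x})`, which holds the symbol, is not nulled. -/
abbrev WIdx (k d m : ℕ) : Type :=
  {p : Fin d × Finset (Fin d) // p.2.card = m + 1 ∧ p.1 ∈ p.2 ∧ (∃ z ∈ p.2, p.1 < z) ∧
    ¬ Nulled k p.1 (p.2.erase p.1)}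

/-- The file symbols of a segment of mode `m`. -/
abbrev SegIdx (k d m : ℕ) : Type := VIdx k d m ⊕ WIdx k d m

section Segment

variable {𝔽 : Type*} [Field 𝔽] {k d m : ℕ}

/-- The symbol `v_{x, X}`, which is `0` if it is nulled. -/
def vSym (t : SegIdx k d m → 𝔽) (x : Fin d) (X : Finset (Fin d)) : 𝔽 :=
  if h : X.card = m ∧ x ∈ X ∧ ¬ Nulled k x X then t (Sum.inl ⟨(x, X), h⟩) else 0

/-- The symbol `w_{x, Y}` for `x ≠ max Y`, which is `0` if it is nulled. -/
def wRaw (t : SegIdx k d m → 𝔽) (x : Fin d) (Y : Finset (Fin d)) : 𝔽 :=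
  if h : Y.card = m + 1 ∧ x ∈ Y ∧ (∃ z ∈ Y, x < z) ∧ ¬ Nulled k x (Y.erase x) then
    t (Sum.inr ⟨(x, Y), h⟩) else 0

/-- The symbol `w_{x, Y}` for any `x ∈ Y`.  For `x = max Y` it is the parity symbol, the solution
of `∑ y ∈ Y, (-1) ^ ind Y y * w_{y, Y} = 0`. -/
def wSym (t : SegIdx k d m → 𝔽) (x : Fin d) (Y : Finset (Fin d)) : 𝔽 :=
  if ∃ z ∈ Y, x < z then wRaw t x Y
  else (-1) ^ (1 + ind Y x) * ∑ y ∈ Y.erase x, (-1) ^ ind Y y * wRaw t y Y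

/-- The message matrix of the signed determinant code of mode `m` with signature `σ`.  For `m = 0`
it vanishes. -/
def detMatrix (σ : Fin d → ℕ) (t : SegIdx k d m → 𝔽) (x : Fin d) (I : Finset (Fin d)) : 𝔽 :=
  (-1) ^ σ x * (if x ∈ I then vSym t x I else wSym t x (insert x I))

/-- The injection matrix for the injection pair `(x, B)` of a parent matrix `P` with
signature `σ`. -/
def injMatrix (σ : Fin d → ℕ) (P : Fin d → Finset (Fin d) → 𝔽) (x : Fin d) (B : Finset (Fin d))
    (i : Fin d) (I : Finset (Fin d)) : 𝔽 :=
  if (∀ z ∈ I, z < i) ∧ i ∉ B ∧ Disjoint I B then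
    (-1) ^ (1 + σ i + ind (insert i (I ∪ B)) i) * P x (insert i (I ∪ B)) else 0

end Segment

/-- The signature of the child with injection pair `(x, B)` of a parent with signature `σ`. -/
def childSign {d : ℕ} (σ : Fin d → ℕ) (B : Finset (Fin d)) (i : Fin d) : ℕ :=
  1 + σ i + ind (insert i B) i

/-! ### The tree of code segments -/

/-- The injection pairs `(x, B)` of a code segment of mode `j`. -/
abbrev InjPair (k d j : ℕ) : Type :=
  {p : Fin d × Finset (Fin d) // (∀ b ∈ p.2, k ≤ b.val) ∧ p.2.card < j ∧ k ≤ p.1.val ∧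
    ∃ b ∈ p.2, p.1 ≤ b}

/-- The code segments of the cascade whose root has mode `j`: the root itself, and, for each
injection pair `p = (x, B)` of the root, the segments of the cascade below the child given by `p`,
whose mode is `j - |B| - 1`. -/
inductive Segment (k d : ℕ) : ℕ → Type
  | root {j : ℕ} : Segment k d j
  | child {j : ℕ} (p : InjPair k d j) (q : Segment k d (j - p.1.2.card - 1)) : Segment k d j

/-- The mode of a code segment. -/
def Segment.mode {k d : ℕ} : {j : ℕ} → Segment k d j → ℕ
  | j, .root => j
  | _, .child _ q => q.mode

/-- The symbols of the file: the file symbols of all code segments. -/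
abbrev FileIdx (k d j : ℕ) : Type := Σ Q : Segment k d j, SegIdx k d Q.mode

/-- The columns of the super message matrix: those of all code segments side by side. -/
abbrev Column (k d j : ℕ) : Type :=
  Σ Q : Segment k d j, {I : Finset (Fin d) // I.card = Q.mode}

section Code

variable {𝔽 : Type*} [Field 𝔽] {k d : ℕ}

/-- The message matrix, after injection, of each segment of a cascade whose root has mode `j` and
signature `σ` and receives the injection matrix `Δ`. -/
def segMatrix : {j : ℕ} → (σ : Fin d → ℕ) → (Δ : Fin d → Finset (Fin d) → 𝔽) →
    (s : FileIdx k d j → 𝔽) → Segment k d j → Fin d → Finset (Fin d) → 𝔽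
  | _, σ, Δ, s, .root => fun x I => detMatrix σ (fun t => s ⟨.root, t⟩) x I + Δ x I
  | _, σ, _, s, .child p q =>
      segMatrix (childSign σ p.1.2)
        (injMatrix σ (detMatrix σ (fun t => s ⟨.root, t⟩)) p.1.1 p.1.2)
        (fun c => s ⟨.child p c.1, c.2⟩) q

/-- The super message matrix: the root has mode `μ` and signature zero, and nothing is injected
into it. -/
def superMessage (μ : ℕ) (s : FileIdx k d μ → 𝔽) : Matrix (Fin d) (Column k d μ) 𝔽 :=
  Matrix.of fun x c => segMatrix (fun _ => 0) (fun _ _ => 0) s c.1 x c.2.1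

/-- The cascade code of mode `μ` with encoder matrix `Ψ`. -/
def cascadeCode {n : ℕ} (μ : ℕ) (Ψ : Matrix (Fin n) (Fin d) 𝔽) (s : FileIdx k d μ → 𝔽) :
    Matrix (Fin n) (Column k d μ) 𝔽 :=
  Ψ * superMessage μ s

end Code

end Cascade

/-! Both decoding claims reduce to kernels: a linear decoder exists once every file for which the
received symbols vanish also makes the wanted symbols vanish (`exists_linearMap_apply_eq`).

Repair. Contraction by the encoder row `ψ` of the failed node is an interior product and squares to
zero (`contr_contr`), so a helper need only send the coordinates avoiding one index `a` with `ψ a ≠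
0`. As any `d` encoder rows are independent, these symbols determine the contractions of all rows of
every segment. By `sum_mul_eq_contr` the lost content is a signed sum of such contractions plus the
contraction of the parity sums. Parity sums vanish for an unmodified message matrix; an injection
with pair `(x, B)` adds minus the contraction of the parent's row `x` at `I ∪ B`
(`contr_paritySum_injMatrix`), which is known too.

Recovery. The first `k` encoder columns decode a column once its lower rows are known. A lower entry
`(x, Y)` with `x ≤ max Y` is either nulled or injected into the child whose `B` is the lower part of
`Y`; the remaining lower entries follow from parity. `eq_zero_of_sum_mul_segMatrix_eq_zero` orders
these steps so that they are not circular.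

Parameters. Columns, repair symbols and file symbols obey one recurrence over the tree. In
generating functions it amounts to division by `(1 + X) ^ l * (1 - l * X)` with `l = d - k`
(`mk_mul_eq_of_recurrence`). -/

namespace Cascade

/-! ### Linear decoding from kernels -/

section LinearAlgebra

theorem eq_zero_of_linearIndependent_rows {𝔽 ι J : Type*} [Field 𝔽] [Fintype ι] [Fintype J]
    (hc : Fintype.card ι = Fintype.card J) {f : ι → J → 𝔽} (hf : LinearIndependent 𝔽 f)
    {u : J → 𝔽} (hu : ∀ i, ∑ j, f i j * u j = 0) : u = 0 := by
  classical
  have hspan : Submodule.span 𝔽 (Set.range f) = ⊤ :=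
    hf.span_eq_top_of_card_eq_finrank' (by simp [hc])
  have key : ∀ v : J → 𝔽, ∑ j, v j * u j = 0 := by
    intro v
    have hv : v ∈ Submodule.span 𝔽 (Set.range f) := by rw [hspan]; trivial
    induction hv using Submodule.span_induction with
    | mem x hx => obtain ⟨i, rfl⟩ := hx; exact hu i
    | zero => simp
    | add x y _ _ hx hy => simp [add_mul, Finset.sum_add_distrib, hx, hy]
    | smul a x _ hx => simp [mul_assoc, ← Finset.mul_sum, hx]
  funext j
  simpa [Pi.single_apply] using key (Pi.single j 1)

/-- The map `g` factors through the quotient by `ker f`, that is, through the range of `f`, and over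
a field it extends from there to `W`. -/
theorem exists_linearMap_apply_eq {𝔽 V W U : Type*} [Field 𝔽] [AddCommGroup V] [Module 𝔽 V]
    [AddCommGroup W] [Module 𝔽 W] [AddCommGroup U] [Module 𝔽 U] (f : V →ₗ[𝔽] W) (g : V →ₗ[𝔽] U)
    (h : ∀ s, f s = 0 → g s = 0) : ∃ R : W →ₗ[𝔽] U, ∀ s, R (f s) = g s := by
  obtain ⟨R, hR⟩ := LinearMap.exists_extend
    (((LinearMap.ker f).liftQ g (fun s hs => h s hs)).comp f.quotKerEquivRange.symm.toLinearMap)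
  refine ⟨R, fun s => ?_⟩
  have := LinearMap.congr_fun hR ⟨f s, LinearMap.mem_range_self f s⟩
  simp only [LinearMap.comp_apply, Submodule.subtype_apply] at this
  rw [this]
  have h2 : f.quotKerEquivRange.symm ⟨f s, LinearMap.mem_range_self f s⟩
      = (LinearMap.ker f).mkQ s := by
    rw [LinearEquiv.symm_apply_eq]; rfl
  rw [LinearEquiv.coe_coe, h2]
  exact Submodule.liftQ_apply _ _ _

end LinearAlgebra

/-! ### Encoder matrices -/

section Encoder

/-- A Vandermonde matrix on `n` distinct points works, since its first `k` columns are again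
Vandermonde. -/
theorem exists_isEncoder {𝔽 : Type*} [Field 𝔽] [Finite 𝔽] {n k d : ℕ} (hkd : k ≤ d)
    (hn : n ≤ Nat.card 𝔽) : ∃ Ψ : Matrix (Fin n) (Fin d) 𝔽, IsEncoder k Ψ := by
  classical
  have := Fintype.ofFinite 𝔽
  obtain ⟨e⟩ : Nonempty (Fin n ↪ 𝔽) :=
    Function.Embedding.nonempty_of_card_le (by simpa [Nat.card_eq_fintype_card] using hn)
  have key : ∀ (m : ℕ) (S : Finset (Fin n)), S.card = m →
      LinearIndependent 𝔽 (fun (i : S) (j : Fin m) => e i ^ (j : ℕ)) := by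
    intro m S hS
    let g : Fin m ≃ S := (S.orderIsoOfFin hS).toEquiv
    have h : (Matrix.vandermonde fun i => e (g i)).det ≠ 0 := by
      rw [Matrix.det_vandermonde_ne_zero_iff]
      exact e.injective.comp (Subtype.val_injective.comp g.injective)
    have h2 := Matrix.linearIndependent_rows_of_det_ne_zero h
    rw [← linearIndependent_equiv g]
    exact h2
  refine ⟨Matrix.of fun i j => e i ^ (j : ℕ), fun S hS => ?_, fun S hS => key d S hS⟩
  let r : {j : Fin d // j.val < k} ≃ Fin k :=
    { toFun := fun j => ⟨j.1.1, j.2⟩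
      invFun := fun j => ⟨⟨j.1, j.2.trans_le hkd⟩, j.2⟩
      left_inv := fun _ => rfl
      right_inv := fun _ => rfl }
  exact (key k S hS).map' (LinearEquiv.funCongrLeft 𝔽 𝔽 r).toLinearMap (LinearEquiv.ker _)

variable {𝔽 : Type*} [Field 𝔽] {n k d : ℕ} {Ψ : Matrix (Fin n) (Fin d) 𝔽}

theorem IsEncoder.eq_zero_of_full (hΨ : IsEncoder k Ψ) {H : Finset (Fin n)} (hH : H.card = d)
    {u : Fin d → 𝔽} (hu : ∀ h ∈ H, ∑ x, Ψ h x * u x = 0) (x : Fin d) : u x = 0 :=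
  congr_fun (eq_zero_of_linearIndependent_rows (by simp [hH]) (hΨ.full H hH)
    (fun h => hu h h.2)) x

theorem IsEncoder.eq_zero_of_left (hΨ : IsEncoder k Ψ) (hkd : k ≤ d) {K : Finset (Fin n)}
    (hK : K.card = k) {u : Fin d → 𝔽} (hu : ∀ h ∈ K, ∑ x, Ψ h x * u x = 0)
    (hlow : ∀ x : Fin d, k ≤ x.val → u x = 0) : u = 0 := by
  classical
  have hc : Fintype.card K = Fintype.card {j : Fin d // j.val < k} := by
    rw [Fintype.card_coe, hK, Fintype.card_subtype, Fin.card_filter_val_lt, min_eq_right hkd]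
  have h0 := eq_zero_of_linearIndependent_rows hc (hΨ.left K hK)
    (u := fun j => u j) (fun h => by
      rw [← hu h h.2, ← Finset.sum_subtype (Finset.univ.filter fun j : Fin d => j.val < k)
        (by simp) (fun x => Ψ h x * u x)]
      refine Finset.sum_subset (Finset.subset_univ _) fun x _ hx => ?_
      rw [hlow x (by simpa using hx), mul_zero])
  funext x
  by_cases hx : x.val < k
  · exact congr_fun h0 ⟨x, hx⟩
  · exact hlow x (not_lt.mp hx)

theorem IsEncoder.exists_ne_zero (hΨ : IsEncoder k Ψ) (hd : 0 < d) (hdn : d ≤ n) (f : Fin n) :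
    ∃ a, Ψ f a ≠ 0 := by
  classical
  obtain ⟨S, hfS, hS⟩ : ∃ S : Finset (Fin n), {f} ⊆ S ∧ S.card = d := by
    obtain ⟨S, h1, _, h2⟩ := Finset.exists_subsuperset_card_eq (Finset.subset_univ {f})
      (by simpa using Nat.succ_le_of_lt hd) (by simpa using hdn)
    exact ⟨S, h1, h2⟩
  have := (hΨ.full S hS).ne_zero ⟨f, by simpa using hfS⟩
  by_contra! h
  exact this (funext h)

end Encoder

/-! ### Contraction by an encoder row and parity sums -/

section Contraction

variable {𝔽 : Type*} [Field 𝔽] {k d : ℕ}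

theorem ind_insert {J : Finset (Fin d)} {x : Fin d} (hx : x ∉ J) (y : Fin d) :
    ind (insert x J) y = ind J y + if x ≤ y then 1 else 0 := by
  unfold ind
  rw [Finset.filter_insert]
  split_ifs
  · rw [Finset.card_insert_of_notMem (by simp [hx])]
  · simp

theorem ind_union {I B : Finset (Fin d)} (h : Disjoint I B) (y : Fin d) :
    ind (I ∪ B) y = ind I y + ind B y := by
  unfold ind
  rw [Finset.filter_union, Finset.card_union_of_disjoint (Finset.disjoint_filter_filter h)]

theorem neg_one_pow_congr {a b : ℕ} (h : a % 2 = b % 2) : (-1 : 𝔽) ^ a = (-1) ^ b := by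
  rw [neg_one_pow_eq_pow_mod_two, h, ← neg_one_pow_eq_pow_mod_two]

theorem neg_one_pow_eq_neg {a b : ℕ} (h : (a + 1) % 2 = b % 2) : (-1 : 𝔽) ^ a = -(-1) ^ b := by
  rw [← neg_one_pow_congr h, pow_succ]; ring

/-- The contraction of a row `g` by the encoder row `ψ`: the product of `g` with the repair
encoder matrix of `ψ`, for the signature `σ`. -/
def contr (σ : Fin d → ℕ) (ψ : Fin d → 𝔽) (g : Finset (Fin d) → 𝔽) (J : Finset (Fin d)) : 𝔽 :=
  ∑ x ∈ Jᶜ, (-1) ^ (σ x + ind (insert x J) x) * ψ x * g (insert x J)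

/-- The signed sum of the entries of `A` which the parity equation of `Y` relates. -/
def paritySum (σ : Fin d → ℕ) (A : Fin d → Finset (Fin d) → 𝔽) (Y : Finset (Fin d)) : 𝔽 :=
  ∑ y ∈ Y, (-1) ^ (σ y + ind Y y) * A y (Y.erase y)

theorem contr_congr {σ : Fin d → ℕ} {ψ : Fin d → 𝔽} {g g' : Finset (Fin d) → 𝔽}
    {J : Finset (Fin d)} (h : ∀ x ∉ J, g (insert x J) = g' (insert x J)) :
    contr σ ψ g J = contr σ ψ g' J :=
  Finset.sum_congr rfl fun x hx => by rw [h x (Finset.mem_compl.mp hx)]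

/-- Inserting `x` then `y`, or `y` then `x`, gives opposite signs: only the larger of the two has
its `ind` raised by the presence of the other. -/
theorem contr_contr (σ : Fin d → ℕ) (ψ : Fin d → 𝔽) (g : Finset (Fin d) → 𝔽)
    (L : Finset (Fin d)) : contr σ ψ (contr σ ψ g) L = 0 := by
  simp only [contr, Finset.mul_sum]
  rw [Finset.sum_sigma']
  refine Finset.sum_involution (fun p _ => ⟨p.2, p.1⟩) ?_ ?_ ?_ ?_
  · rintro ⟨x, y⟩ h
    simp only [Finset.mem_sigma, Finset.mem_compl, Finset.mem_insert, not_or] at h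
    obtain ⟨hx, hyx, hy⟩ := h
    have e : (-1 : 𝔽) ^ (σ x + ind (insert x L) x + (σ y + ind (insert y (insert x L)) y))
        = -(-1) ^ (σ y + ind (insert y L) y + (σ x + ind (insert x (insert y L)) x)) := by
      apply neg_one_pow_eq_neg
      rw [ind_insert (x := y) (J := insert x L) (by simp [hyx, hy]),
        ind_insert (x := x) (J := insert y L) (by simp [Ne.symm hyx, hx]),
        ind_insert hx, ind_insert hx, ind_insert hy, ind_insert hy]
      rcases lt_or_gt_of_ne hyx with h | h
      · simp [h.le, not_le.mpr h]; omega
      · simp [h.le, not_le.mpr h]; omega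
    simp only [pow_add] at e ⊢
    linear_combination (ψ x * ψ y * g (insert y (insert x L))) * e +
      ((-1) ^ σ y * (-1) ^ ind (insert y L) y * ψ y * ((-1) ^ σ x *
        (-1) ^ ind (insert x (insert y L)) x * ψ x)) *
        congrArg g (Finset.insert_comm x y L)
  · rintro ⟨x, y⟩ h _ h'
    simp only [Finset.mem_sigma, Finset.mem_compl, Finset.mem_insert, not_or] at h
    simp only [Sigma.mk.injEq, heq_eq_eq] at h'
    exact h.2.1 h'.1
  · rintro ⟨x, y⟩ h
    simp only [Finset.mem_sigma, Finset.mem_compl, Finset.mem_insert, not_or] at h ⊢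
    exact ⟨h.2.2, Ne.symm h.2.1, h.1⟩
  · rintro ⟨x, y⟩ _; rfl

/-- For `a ∈ J`, only the term `x = a` survives in the double contraction at `J.erase a`, and its
coefficient is nonzero. This is the saving that brings the bandwidth down to `β`. -/
theorem contr_eq_zero_of_notMem {σ : Fin d → ℕ} {ψ : Fin d → 𝔽} {g : Finset (Fin d) → 𝔽}
    {a : Fin d} (ha : ψ a ≠ 0) {m : ℕ}
    (h : ∀ J : Finset (Fin d), J.card = m → a ∉ J → contr σ ψ g J = 0)
    (J : Finset (Fin d)) (hJ : J.card = m) : contr σ ψ g J = 0 := by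
  by_cases haJ : a ∈ J
  · have h0 := contr_contr σ ψ g (J.erase a)
    rw [contr, Finset.sum_eq_single a] at h0
    · rw [Finset.insert_erase haJ] at h0
      simpa [ha] using h0
    · intro x hx hxa
      have hx' : x ∉ J.erase a := Finset.mem_compl.mp hx
      rw [h _ _ (by simp [Ne.symm hxa]), mul_zero]
      rw [Finset.card_insert_of_notMem hx', Finset.card_erase_add_one haJ, hJ]
    · simp
  · exact h J hJ haJ

/-- The diagonal terms of the two parts give the summands with `x ∈ I` and `x ∉ I` respectively. The
mixed terms, which exchange some `i ∈ I` for some `x ∉ I`, occur in both parts with opposite signs.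
-/
theorem sum_mul_eq_contr (σ : Fin d → ℕ) (ψ : Fin d → 𝔽) (A : Fin d → Finset (Fin d) → 𝔽)
    (I : Finset (Fin d)) :
    ∑ x, ψ x * A x I = ∑ i ∈ I, (-1) ^ (σ i + ind I i) * contr σ ψ (A i) (I.erase i) +
      contr σ ψ (paritySum σ A) I := by
  have h1 : ∀ i ∈ I, (-1) ^ (σ i + ind I i) * contr σ ψ (A i) (I.erase i) = ψ i * A i I +
      ∑ x ∈ Iᶜ, (-1) ^ (σ i + ind I i) * ((-1) ^ (σ x + ind (insert x (I.erase i)) x) * ψ x *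
        A i (insert x (I.erase i))) := by
    intro i hi
    have hc : (I.erase i)ᶜ = insert i Iᶜ := by
      ext y; by_cases hy : y = i <;> simp [hy]
    rw [contr, hc, Finset.sum_insert (by simpa using hi), Finset.insert_erase hi, mul_add,
      Finset.mul_sum, ← mul_assoc, ← mul_assoc, ← pow_add, ← two_mul, pow_mul]
    simp
  have h2 : ∀ x ∈ Iᶜ, (-1) ^ (σ x + ind (insert x I) x) * ψ x * paritySum σ A (insert x I) =
      ψ x * A x I + ∑ i ∈ I, (-1) ^ (σ x + ind (insert x I) x) * ψ x *
        ((-1) ^ (σ i + ind (insert x I) i) * A i ((insert x I).erase i)) := by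
    intro x hx
    have hx' : x ∉ I := Finset.mem_compl.mp hx
    rw [paritySum, Finset.sum_insert hx', Finset.erase_insert hx', mul_add, Finset.mul_sum]
    congr 1
    have : ((-1 : 𝔽) ^ (σ x + ind (insert x I) x)) * (-1) ^ (σ x + ind (insert x I) x) = 1 := by
      rw [← pow_add, ← two_mul, pow_mul]; simp
    linear_combination ψ x * A x I * this
  rw [Finset.sum_congr rfl h1, contr, Finset.sum_congr rfl h2, Finset.sum_add_distrib,
    Finset.sum_add_distrib, Finset.sum_comm (s := Iᶜ), ← Finset.sum_add_sum_compl I]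
  have h3 : ∑ i ∈ I, ∑ x ∈ Iᶜ, (-1) ^ (σ i + ind I i) *
        ((-1) ^ (σ x + ind (insert x (I.erase i)) x) * ψ x * A i (insert x (I.erase i))) =
      -∑ i ∈ I, ∑ x ∈ Iᶜ, (-1) ^ (σ x + ind (insert x I) x) * ψ x *
        ((-1) ^ (σ i + ind (insert x I) i) * A i ((insert x I).erase i)) := by
    rw [← Finset.sum_neg_distrib]
    refine Finset.sum_congr rfl fun i hi => ?_
    rw [← Finset.sum_neg_distrib]
    refine Finset.sum_congr rfl fun x hx => ?_
    have hx' : x ∉ I := Finset.mem_compl.mp hx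
    have hne : x ≠ i := fun h => hx' (h ▸ hi)
    have hx'' : x ∉ I.erase i := fun h => hx' (Finset.mem_of_mem_erase h)
    have hI : ∀ y, ind I y = ind (I.erase i) y + if i ≤ y then 1 else 0 := fun y => by
      rw [← ind_insert (Finset.notMem_erase i I), Finset.insert_erase hi]
    rw [Finset.erase_insert_of_ne hne]
    have e : (-1 : 𝔽) ^ (σ i + ind I i + (σ x + ind (insert x (I.erase i)) x)) =
        -(-1) ^ (σ x + ind (insert x I) x + (σ i + ind (insert x I) i)) := by
      apply neg_one_pow_eq_neg
      rw [ind_insert hx', ind_insert hx', ind_insert hx'', hI, hI]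
      rcases lt_or_gt_of_ne hne with h | h
      · simp [h.le, not_le.mpr h]; omega
      · simp [h.le, not_le.mpr h]; omega
    simp only [pow_add] at e ⊢
    linear_combination (ψ x * A i (insert x (I.erase i))) * e
  rw [h3]
  ring

theorem paritySum_add (σ : Fin d → ℕ) (A A' : Fin d → Finset (Fin d) → 𝔽) (Y : Finset (Fin d)) :
    paritySum σ (fun x I => A x I + A' x I) Y = paritySum σ A Y + paritySum σ A' Y := by
  simp [paritySum, mul_add, Finset.sum_add_distrib]

theorem paritySum_detMatrix {m : ℕ} (σ : Fin d → ℕ) (t : SegIdx k d m → 𝔽)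
    (Y : Finset (Fin d)) : paritySum σ (detMatrix σ t) Y = 0 := by
  have h1 : paritySum σ (detMatrix σ t) Y = ∑ y ∈ Y, (-1) ^ ind Y y * wSym t y Y := by
    refine Finset.sum_congr rfl fun y hy => ?_
    rw [detMatrix, if_neg (Finset.notMem_erase y Y), Finset.insert_erase hy, pow_add]
    have : ((-1 : 𝔽) ^ σ y) * (-1) ^ σ y = 1 := by rw [← pow_add, ← two_mul, pow_mul]; simp
    linear_combination ((-1) ^ ind Y y * wSym t y Y) * this
  rw [h1]
  rcases Y.eq_empty_or_nonempty with rfl | hY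
  · simp
  have hz := Y.max'_mem hY
  have hmax : ∀ y ∈ Y, y ≤ Y.max' hY := fun y hy => Y.le_max' y hy
  set z := Y.max' hY
  rw [← Finset.add_sum_erase Y _ hz]
  have h2 : ∀ y ∈ Y.erase z, (-1) ^ ind Y y * wSym t y Y = (-1) ^ ind Y y * wRaw t y Y := by
    intro y hy
    rw [Finset.mem_erase] at hy
    rw [wSym, if_pos ⟨z, hz, lt_of_le_of_ne (hmax y hy.2) hy.1⟩]
  rw [Finset.sum_congr rfl h2, wSym, if_neg (by push Not; exact hmax), ← mul_assoc, ← pow_add,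
    neg_one_pow_congr (b := 1) (by omega)]
  ring

/-- Injection affects only rows exceeding their column, so only `y = max Y` contributes. The child's
signature is designed so that the sign is always `-1`. -/
theorem paritySum_injMatrix (σ : Fin d → ℕ) (P : Fin d → Finset (Fin d) → 𝔽) (x : Fin d)
    (B Y : Finset (Fin d)) (hY : Y.Nonempty) :
    paritySum (childSign σ B) (injMatrix σ P x B) Y =
      if Disjoint Y B then -P x (Y ∪ B) else 0 := by
  have hz := Y.max'_mem hY
  have hmax : ∀ y ∈ Y, y ≤ Y.max' hY := fun y hy => Y.le_max' y hy
  set z := Y.max' hY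
  rw [paritySum, Finset.sum_eq_single_of_mem z hz]
  · have hlt : ∀ y ∈ Y.erase z, y < z := fun y hy =>
      lt_of_le_of_ne (hmax y (Finset.mem_of_mem_erase hy)) (Finset.ne_of_mem_erase hy)
    have hiff : ((∀ y ∈ Y.erase z, y < z) ∧ z ∉ B ∧ Disjoint (Y.erase z) B) ↔ Disjoint Y B := by
      rw [← Finset.disjoint_insert_left, Finset.insert_erase hz]
      exact and_iff_right hlt
    rw [injMatrix]
    simp only [hiff]
    split_ifs with h
    · rw [← Finset.insert_union, Finset.insert_erase hz, ← mul_assoc, ← pow_add,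
        neg_one_pow_congr (b := 1)]
      · ring
      · have : z ∉ B := Finset.disjoint_left.mp h hz
        rw [childSign, ind_insert this, ind_union h]
        simp; omega
    · simp
  · intro y hy hyz
    rw [injMatrix, if_neg, mul_zero]
    rintro ⟨h, -⟩
    exact absurd (h z (Finset.mem_erase.mpr ⟨Ne.symm hyz, hz⟩)) (not_lt.mpr (hmax y hy))

theorem contr_paritySum_injMatrix (σ : Fin d → ℕ) (ψ : Fin d → 𝔽)
    (P : Fin d → Finset (Fin d) → 𝔽) (x : Fin d) (B I : Finset (Fin d)) :
    contr (childSign σ B) ψ (paritySum (childSign σ B) (injMatrix σ P x B)) I =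
      if Disjoint I B then -contr σ ψ (P x) (I ∪ B) else 0 := by
  rw [contr]
  simp only [paritySum_injMatrix σ P x B _ (Finset.insert_nonempty _ _),
    Finset.disjoint_insert_left]
  split_ifs with h
  · rw [contr, ← Finset.sum_neg_distrib]
    symm
    -- Indices `y ∈ B` drop out, as `insert y I` then meets `B`; what remains is the index range of
    -- the contraction at `I ∪ B`.
    refine Finset.sum_subset_zero_on_sdiff (fun y => by simp +contextual) ?_ ?_
    · intro y hy
      simp only [Finset.mem_sdiff, Finset.mem_compl, Finset.mem_union, not_or, not_and,
        not_not] at hy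
      simp [hy.2 hy.1]
    · intro y hy
      simp only [Finset.mem_compl, Finset.mem_union, not_or] at hy
      have hd : Disjoint (insert y I) B := Finset.disjoint_insert_left.mpr ⟨hy.2, h⟩
      rw [if_pos ⟨hy.2, h⟩, Finset.insert_union,
        neg_one_pow_congr (a := childSign σ B y + ind (insert y I) y)
          (b := σ y + ind (insert y (I ∪ B)) y)]
      · ring
      · rw [← Finset.insert_union, ind_union hd, childSign, ind_insert hy.2]
        simp; omega
  · simp [h]

end Contraction

/-! ### Vanishing of the failed node's content -/

section Repair

variable {𝔽 : Type*} [Field 𝔽] {k d : ℕ}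

/-- The signature of a code segment of a cascade whose root has signature `σ`. -/
def segSign : {j : ℕ} → (σ : Fin d → ℕ) → Segment k d j → Fin d → ℕ
  | _, σ, .root => σ
  | _, σ, .child p q => segSign (childSign σ p.1.2) q

theorem sum_mul_segMatrix_eq_zero (ψ : Fin d → 𝔽) {j : ℕ} (Q : Segment k d j)
    (σ : Fin d → ℕ) (Δ : Fin d → Finset (Fin d) → 𝔽) (s : FileIdx k d j → 𝔽)
    (hΔ : ∀ i I, (∃ z ∈ I, i ≤ z) → Δ i I = 0)
    (hpar : ∀ I, I.card = j → contr σ ψ (paritySum σ Δ) I = 0)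
    (h : ∀ Q : Segment k d j, ∀ i J, J.card + 1 = Q.mode →
      contr (segSign σ Q) ψ (segMatrix σ Δ s Q i) J = 0)
    (I : Finset (Fin d)) (hI : I.card = Q.mode) :
    ∑ x, ψ x * segMatrix σ Δ s Q x I = 0 := by
  induction Q generalizing σ Δ with
  | @root j =>
    rw [sum_mul_eq_contr σ, Finset.sum_eq_zero, zero_add]
    · rw [← hpar I hI]
      refine contr_congr fun x _ => ?_
      simp only [segMatrix, paritySum_add, paritySum_detMatrix, zero_add]
    · intro i hi
      rw [show contr σ ψ (segMatrix σ Δ s Segment.root i) (I.erase i) = 0 from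
        h .root i _ (by rw [Finset.card_erase_add_one hi, hI]), mul_zero]
  | @child j p q ih =>
    refine ih (childSign σ p.1.2)
      (injMatrix σ (detMatrix σ (fun t => s ⟨.root, t⟩)) p.1.1 p.1.2)
      (fun c => s ⟨.child p c.1, c.2⟩) ?_ ?_ (fun Q => h (.child p Q)) hI
    · rintro i I ⟨z, hz, hiz⟩
      rw [injMatrix, if_neg]
      rintro ⟨h, -⟩
      exact absurd (h z hz) (not_lt.mpr hiz)
    · intro I hI
      rw [contr_paritySum_injMatrix]
      split_ifs with hd
      · obtain ⟨-, hB, -, b, hb, hxb⟩ := p.2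
        rw [neg_eq_zero, ← h .root p.1.1 (I ∪ p.1.2) (by
          rw [Finset.card_union_of_disjoint hd]; simp only [Segment.mode]; omega)]
        refine contr_congr fun y _ => ?_
        simp only [segMatrix]
        -- The hypothesis concerns the modified parent, whereas the unmodified one is injected; they
        -- agree here because `x ≤ b ∈ B`.
        rw [hΔ p.1.1 _ ⟨b, by simp [hb], hxb⟩, add_zero]
      · rfl

end Repair

/-! ### Data recovery -/

section Recovery

variable {𝔽 : Type*} [Field 𝔽] {k d : ℕ}

theorem detMatrix_eq_zero_of_nulled {m : ℕ} (σ : Fin d → ℕ) (t : SegIdx k d m → 𝔽) {x : Fin d}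
    {I : Finset (Fin d)} (h : Nulled k x I) : detMatrix σ t x I = 0 := by
  rw [detMatrix]
  split_ifs with hx
  · rw [vSym, dif_neg (fun h' => h'.2.2 h), mul_zero]
  · obtain ⟨b, hb, hxb⟩ := h.2.1
    have hlt : x < b := lt_of_le_of_ne hxb fun e => hx (e ▸ hb)
    rw [wSym, if_pos ⟨b, Finset.mem_insert_of_mem hb, hlt⟩, wRaw, dif_neg, mul_zero]
    rintro ⟨-, -, -, h'⟩
    rw [Finset.erase_insert hx] at h'
    exact h' h

/-- Every file symbol occupies a position with `x ≤ max I`; all other positions are parities. -/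
theorem eq_zero_of_detMatrix_eq_zero {m : ℕ} (σ : Fin d → ℕ) (t : SegIdx k d m → 𝔽)
    (h : ∀ x I, I.card = m → (∃ b ∈ I, x ≤ b) → detMatrix σ t x I = 0) : t = 0 := by
  have hne : ∀ x, (-1 : 𝔽) ^ σ x ≠ 0 := fun x => pow_ne_zero _ (by simp)
  funext c
  rcases c with ⟨⟨x, X⟩, hX⟩ | ⟨⟨x, Y⟩, hY⟩
  · have := h x X hX.1 ⟨x, hX.2.1, le_rfl⟩
    rw [detMatrix, if_pos hX.2.1, vSym, dif_pos hX] at this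
    exact (mul_eq_zero.mp this).resolve_left (hne x)
  · obtain ⟨z, hz, hxz⟩ := hY.2.2.1
    have := h x (Y.erase x) (by rw [Finset.card_erase_of_mem hY.2.1, hY.1]; rfl)
      ⟨z, Finset.mem_erase.mpr ⟨hxz.ne', hz⟩, hxz.le⟩
    rw [detMatrix, if_neg (Finset.notMem_erase x Y), Finset.insert_erase hY.2.1, wSym,
      if_pos ⟨z, hz, hxz⟩, wRaw, dif_pos hY] at this
    exact (mul_eq_zero.mp this).resolve_left (hne x)

theorem detMatrix_zero {m : ℕ} (σ : Fin d → ℕ) (x : Fin d) (I : Finset (Fin d)) :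
    detMatrix σ (0 : SegIdx k d m → 𝔽) x I = 0 := by
  simp [detMatrix, vSym, wSym, wRaw]

/-- With `B` the lower part of `Y` and `i` the largest upper element, the injection carries `± P x
Y` in row `i`. -/
theorem eq_zero_of_injMatrix_eq_zero {j : ℕ} {σ : Fin d → ℕ} {P : Fin d → Finset (Fin d) → 𝔽}
    {x : Fin d} {Y : Finset (Fin d)} (hY : Y.card = j)
    (hup : ∃ a ∈ Y, a.val < k)
    (h : ∀ i I, I.card = j - (Y.filter fun b => k ≤ b.val).card - 1 →
      injMatrix σ P x (Y.filter fun b => k ≤ b.val) i I = 0) : P x Y = 0 := by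
  set B := Y.filter fun b => k ≤ b.val with hB
  set U := Y.filter fun b => ¬ k ≤ b.val with hU
  have hne : U.Nonempty := by
    obtain ⟨a, ha, hak⟩ := hup
    exact ⟨a, by simp [hU, ha, hak]⟩
  have hdisj : Disjoint U B := (Finset.disjoint_filter_filter_not _ _ _).symm
  have hUB : U ∪ B = Y := by rw [Finset.union_comm]; exact Finset.filter_union_filter_not_eq _ _
  have hcard : U.card + B.card = j := by
    rw [← Finset.card_union_of_disjoint hdisj, hUB, hY]
  have hi := U.max'_mem hne
  have hmax : ∀ y ∈ U, y ≤ U.max' hne := fun y hy => U.le_max' y hy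
  set i := U.max' hne
  have h0 := h i (U.erase i) (by rw [Finset.card_erase_of_mem hi]; omega)
  rw [injMatrix, if_pos, ← Finset.insert_union, Finset.insert_erase hi, hUB] at h0
  · exact (mul_eq_zero.mp h0).resolve_left (pow_ne_zero _ (by simp))
  · exact ⟨fun z hz => lt_of_le_of_ne (hmax z (Finset.mem_of_mem_erase hz))
      (Finset.ne_of_mem_erase hz), Finset.disjoint_left.mp hdisj hi,
      hdisj.mono_left (Finset.erase_subset _ _)⟩

/-- If the injection into the root vanishes in the lower rows and the nodes of `K` store zeros,
then the file and the injection vanish. -/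
theorem eq_zero_of_sum_mul_segMatrix_eq_zero {n : ℕ} {Ψ : Matrix (Fin n) (Fin d) 𝔽}
    (hΨ : IsEncoder k Ψ) (hkd : k ≤ d) {K : Finset (Fin n)} (hK : K.card = k) (j : ℕ)
    (σ : Fin d → ℕ) (Δ : Fin d → Finset (Fin d) → 𝔽) (s : FileIdx k d j → 𝔽)
    (hΔ : ∀ i I, (∃ z ∈ I, i ≤ z) → Δ i I = 0)
    (hlow : ∀ i I, k ≤ i.val → I.card = j → Δ i I = 0)
    (h : ∀ (Q : Segment k d j) I, I.card = Q.mode → ∀ f ∈ K,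
      ∑ x, Ψ f x * segMatrix σ Δ s Q x I = 0) :
    (∀ i I, I.card = j → Δ i I = 0) ∧ s = 0 := by
  induction j using Nat.strong_induction_on generalizing σ Δ with
  | _ j ih =>
  set P : Fin d → Finset (Fin d) → 𝔽 := detMatrix σ (fun t => s ⟨.root, t⟩) with hP
  have hnull : ∀ x Y, Nulled k x Y → P x Y = 0 := fun x Y hN =>
    detMatrix_eq_zero_of_nulled σ _ hN
  -- Children are treated from large `B` to small. A lower row `i` of the injection holds an entry
  -- of `P` whose column contains `B` and `i`: it is nulled or was injected into a child with a
  -- larger `B`. Hence the induction on the mode applies to the child.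
  have hchild : ∀ (N : ℕ) (p : InjPair k d j), j - p.1.2.card = N →
      (∀ i I, I.card = j - p.1.2.card - 1 → injMatrix σ P p.1.1 p.1.2 i I = 0) ∧
      (fun c : FileIdx k d (j - p.1.2.card - 1) => s ⟨.child p c.1, c.2⟩) = 0 := by
    intro N
    induction N using Nat.strong_induction_on with
    | _ N ihN =>
    rintro ⟨⟨x, B⟩, hBlow, hBj, hx, b, hb, hxb⟩ hN
    simp only at hBlow hBj hx hb hxb hN
    refine ih (j - B.card - 1) (by omega) (childSign σ B) (injMatrix σ P x B) _ ?_ ?_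
      
      (fun Q => h (.child ⟨(x, B), hBlow, hBj, hx, b, hb, hxb⟩ Q))
    · rintro i I ⟨z, hz, hiz⟩
      rw [injMatrix, if_neg]
      rintro ⟨h, -⟩
      exact absurd (h z hz) (not_lt.mpr hiz)
    · intro i I hi hI
      rw [injMatrix]
      split_ifs with hc
      swap
      · rfl
      obtain ⟨hlt, hiB, hIB⟩ := hc
      have hiI : i ∉ I := fun h => lt_irrefl _ (hlt i h)
      have hcard : (insert i (I ∪ B)).card = j := by
        rw [Finset.card_insert_of_notMem (by simp [hiI, hiB]), Finset.card_union_of_disjoint hIB]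
        omega
      have hbY : b ∈ insert i (I ∪ B) := by simp [hb]
      suffices P x (insert i (I ∪ B)) = 0 by rw [this, mul_zero]
      by_cases hall : ∀ a ∈ insert i (I ∪ B), k ≤ a.val
      · exact hnull _ _ ⟨hx, ⟨b, hbY, hxb⟩, hall⟩
      · push Not at hall
        refine eq_zero_of_injMatrix_eq_zero (σ := σ) hcard hall ?_
        have hsub : insert i B ⊆ (insert i (I ∪ B)).filter fun b => k ≤ b.val := by
          intro y hy
          rcases Finset.mem_insert.mp hy with rfl | hy
          · simp [hi]
          · simp [hy, hBlow y hy]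
        have h1 := Finset.card_le_card hsub
        rw [Finset.card_insert_of_notMem hiB] at h1
        have h2 : ((insert i (I ∪ B)).filter fun b => k ≤ b.val).card < j := by
          rw [← hcard]
          refine Finset.card_lt_card (Finset.filter_ssubset.mpr ?_)
          simpa using hall
        exact (ihN (j - ((insert i (I ∪ B)).filter fun b => k ≤ b.val).card) (by omega) ⟨(x, (insert i (I ∪ B)).filter fun b => k ≤ b.val),
          by simp, h2, hx, b, hsub (by simp [hb]), hxb⟩ rfl).1
  have hlower : ∀ x Y, k ≤ x.val → Y.card = j → (∃ b ∈ Y, x ≤ b) → P x Y = 0 := by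
    rintro x Y hx hY ⟨b, hb, hxb⟩
    by_cases hall : ∀ a ∈ Y, k ≤ a.val
    · exact hnull _ _ ⟨hx, ⟨b, hb, hxb⟩, hall⟩
    · push Not at hall
      refine eq_zero_of_injMatrix_eq_zero (σ := σ) hY hall ?_
      refine (hchild _ ⟨(x, Y.filter fun b => k ≤ b.val), by simp, ?_, hx, b, ?_, hxb⟩ rfl).1
      · rw [← hY]
        refine Finset.card_lt_card (Finset.filter_ssubset.mpr ?_)
        simpa using hall
      · simp [hb, le_trans hx hxb]
  -- Induction on the number of upper indices in the column: parity expresses a lower entry with `x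
  -- > max I` through entries `y` of columns where `x` replaces `y`, and replacing an upper `y`
  -- lowers that number.
  have hcol : ∀ (N : ℕ) (I : Finset (Fin d)), (I.filter fun a => a.val < k).card = N →
      I.card = j → ∀ x, P x I + Δ x I = 0 := by
    intro N
    induction N using Nat.strong_induction_on with
    | _ N ihN =>
    intro I hN hI
    refine fun x => congr_fun (hΨ.eq_zero_of_left hkd hK (u := fun x => P x I + Δ x I)
      (fun f hf => ?_) fun x hx => ?_) x
    · have := h .root I hI f hf
      simpa only [segMatrix] using this
    · rw [hlow x I hx hI, add_zero]
      by_cases hb : ∃ b ∈ I, x ≤ b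
      · exact hlower x I hx hI hb
      · push Not at hb
        have hxI : x ∉ I := fun h => lt_irrefl _ (hb x h)
        have h0 := paritySum_detMatrix σ (fun t => s ⟨Segment.root, t⟩) (insert x I)
        rw [← hP, paritySum, Finset.sum_insert hxI, Finset.erase_insert hxI,
          Finset.sum_eq_zero, add_zero] at h0
        · exact (mul_eq_zero.mp h0).resolve_left (pow_ne_zero _ (by simp))
        · intro y hy
          have hyx : y ≠ x := fun e => hxI (e ▸ hy)
          have hxJ : x ∈ (insert x I).erase y := by simp [Ne.symm hyx]
          have hJ : ((insert x I).erase y).card = j := by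
            rw [Finset.card_erase_of_mem (by simp [hy]), Finset.card_insert_of_notMem hxI, hI]
            rfl
          suffices P y ((insert x I).erase y) = 0 by rw [this, mul_zero]
          by_cases hyk : k ≤ y.val
          · exact hlower y _ hyk hJ ⟨x, hxJ, (hb y hy).le⟩
          · have := ihN _ (by
              rw [← hN]
              refine Finset.card_lt_card (Finset.ssubset_iff_of_subset ?_ |>.mpr ⟨y, ?_, ?_⟩)
              · intro z hz
                simp only [Finset.mem_filter, Finset.mem_erase, Finset.mem_insert] at hz ⊢
                refine ⟨hz.1.2.resolve_left ?_, hz.2⟩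
                rintro rfl
                omega
              · simp [hy, not_le.mp hyk]
              · simp) ((insert x I).erase y) rfl hJ y
            rwa [hΔ y _ ⟨x, hxJ, (hb y hy).le⟩, add_zero] at this
  have hroot : (fun t => s ⟨Segment.root, t⟩) = 0 :=
    eq_zero_of_detMatrix_eq_zero σ _ fun x I hI hb => by
      rw [← hP, ← hcol _ I rfl hI x, hΔ x I hb, add_zero]
  refine ⟨fun i I hI => ?_, ?_⟩
  · have := hcol _ I rfl hI i
    rwa [hP, hroot, detMatrix_zero, zero_add] at this
  · funext ⟨Q, c⟩
    cases Q with
    | root => exact congr_fun hroot c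
    | child p q => exact congr_fun (hchild _ p rfl).2 ⟨q, c⟩

end Recovery

/-! ### Counting symbols and segments -/

section Counting

theorem card_filter_mem_of_card_eq {d : ℕ} (U : Finset (Fin d)) (m : ℕ) :
    (Finset.univ.filter fun p : Fin d × Finset (Fin d) =>
      p.2 ⊆ U ∧ p.2.card = m ∧ p.1 ∈ p.2).card = m * U.card.choose m := by
  rw [Finset.card_eq_sum_card_fiberwise (f := Prod.snd) (t := U.powersetCard m)
    (fun p hp => by
      simp only [Finset.coe_filter, Finset.mem_univ, true_and, Set.mem_ofPred_eq] at hp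
      exact Finset.mem_coe.mpr (Finset.mem_powersetCard.mpr ⟨hp.1, hp.2.1⟩))]
  rw [Finset.sum_congr rfl (g := fun _ => m), Finset.sum_const, Finset.card_powersetCard,
    smul_eq_mul, mul_comm]
  intro X hX
  rw [Finset.mem_powersetCard] at hX
  rw [← hX.2]
  refine Finset.card_nbij' Prod.fst (fun x => (x, X)) ?_ ?_ ?_ ?_
  · rintro ⟨x, Y⟩ h
    simp only [Finset.coe_filter, Finset.mem_filter, Finset.mem_univ, true_and,
      Set.mem_ofPred_eq] at h
    obtain ⟨h, rfl⟩ := h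
    exact h.2.2
  · intro x hx
    simpa [hX] using hx
  · rintro ⟨x, Y⟩ h
    simp only [Finset.coe_filter, Finset.mem_filter, Finset.mem_univ, true_and,
      Set.mem_ofPred_eq] at h
    simp [h.2]
  · intro x _; rfl

theorem card_filter_mem_lt_of_card_eq {d : ℕ} (U : Finset (Fin d)) (m : ℕ) :
    (Finset.univ.filter fun p : Fin d × Finset (Fin d) =>
      p.2 ⊆ U ∧ p.2.card = m + 1 ∧ p.1 ∈ p.2 ∧ ∃ z ∈ p.2, p.1 < z).card =
      m * U.card.choose (m + 1) := by
  rw [Finset.card_eq_sum_card_fiberwise (f := Prod.snd) (t := U.powersetCard (m + 1))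
    (fun p hp => by
      simp only [Finset.coe_filter, Finset.mem_univ, true_and, Set.mem_ofPred_eq] at hp
      exact Finset.mem_coe.mpr (Finset.mem_powersetCard.mpr ⟨hp.1, hp.2.1⟩))]
  rw [Finset.sum_congr rfl (g := fun _ => m), Finset.sum_const, Finset.card_powersetCard,
    smul_eq_mul, mul_comm]
  intro X hX
  rw [Finset.mem_powersetCard] at hX
  have hne : X.Nonempty := Finset.card_pos.mp (by omega)
  have hm : (X.erase (X.max' hne)).card = m := by
    rw [Finset.card_erase_of_mem (X.max'_mem hne), hX.2]; rfl
  rw [← hm]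
  refine Finset.card_nbij' Prod.fst (fun x => (x, X)) ?_ ?_ ?_ ?_
  · rintro ⟨x, Y⟩ h
    simp only [Finset.coe_filter, Finset.mem_filter, Finset.mem_univ, true_and,
      Set.mem_ofPred_eq] at h
    obtain ⟨⟨-, -, h, z, hz, hxz⟩, rfl⟩ := h
    exact Finset.mem_coe.mpr (Finset.mem_erase.mpr ⟨(hxz.trans_le (Y.le_max' z hz)).ne, h⟩)
  · intro x hx
    have hx := Finset.mem_erase.mp (Finset.mem_coe.mp hx)
    simp only [Finset.coe_filter, Finset.mem_filter, Finset.mem_univ, true_and,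
      Set.mem_ofPred_eq, and_true]
    exact ⟨hX.1, hX.2.trans (by rw [hm]), hx.2, _, X.max'_mem hne, lt_of_le_of_ne (X.le_max' x hx.2) hx.1⟩
  · rintro ⟨x, Y⟩ h
    simp only [Finset.coe_filter, Finset.mem_filter, Finset.mem_univ, true_and,
      Set.mem_ofPred_eq] at h
    simp [h.2]
  · intro x _; rfl

/-- The indices of the lower rows. -/
def lowerRows (k d : ℕ) : Finset (Fin d) := Finset.univ.filter fun x => k ≤ x.val

theorem mem_lowerRows {k d : ℕ} {x : Fin d} : x ∈ lowerRows k d ↔ k ≤ x.val := by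
  simp [lowerRows]

theorem card_lowerRows {k d : ℕ} (hkd : k ≤ d) : (lowerRows k d).card = d - k := by
  have h := Finset.card_filter_add_card_filter_not (s := (Finset.univ : Finset (Fin d)))
    (p := fun x : Fin d => x.val < k)
  rw [Fin.card_filter_val_lt, min_eq_right hkd] at h
  simp only [not_lt, Finset.card_univ, Fintype.card_fin] at h
  unfold lowerRows
  omega

theorem choose_succ_mul (l m : ℕ) :
    m * (l + 1).choose (m + 1) = m * l.choose m + m * l.choose (m + 1) := by
  rw [Nat.choose_succ_succ, mul_add]

/-- The nulled symbols are those whose index set lies entirely in the lower rows, so they are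
counted by the same formula with `d - k` in place of `d`. -/
theorem card_segIdx {k d : ℕ} (hkd : k ≤ d) (m : ℕ) :
    Nat.card (SegIdx k d m) + m * (d - k + 1).choose (m + 1) = m * (d + 1).choose (m + 1) := by
  have hU : (Finset.univ : Finset (Fin d)).card = d := by simp
  have hV : Nat.card (VIdx k d m) + m * (d - k).choose m = m * d.choose m := by
    rw [← card_lowerRows hkd, ← card_filter_mem_of_card_eq]
    conv_rhs =>
      rw [← hU, ← card_filter_mem_of_card_eq,
        ← Finset.card_filter_add_card_filter_not (fun p : Fin d × Finset (Fin d) =>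
          ¬ Nulled k p.1 p.2), Finset.filter_filter, Finset.filter_filter]
    rw [Nat.card_eq_fintype_card, Fintype.card_subtype]
    congr 2
    · ext p; simp [and_assoc]
    · ext ⟨x, X⟩
      simp only [Finset.mem_filter, Finset.mem_univ, true_and, implies_true, not_not,
        Finset.subset_iff, mem_lowerRows]
      constructor
      · rintro ⟨h, hm, hx⟩
        exact ⟨⟨hm, hx⟩, h hx, ⟨x, hx, le_rfl⟩, fun a ha => h ha⟩
      · rintro ⟨⟨hm, hx⟩, -, -, h⟩
        exact ⟨fun a ha => h a ha, hm, hx⟩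
  have hW : Nat.card (WIdx k d m) + m * (d - k).choose (m + 1) = m * d.choose (m + 1) := by
    rw [← card_lowerRows hkd, ← card_filter_mem_lt_of_card_eq]
    conv_rhs =>
      rw [← hU, ← card_filter_mem_lt_of_card_eq,
        ← Finset.card_filter_add_card_filter_not (fun p : Fin d × Finset (Fin d) =>
          ¬ Nulled k p.1 (p.2.erase p.1)), Finset.filter_filter, Finset.filter_filter]
    rw [Nat.card_eq_fintype_card, Fintype.card_subtype]
    congr 2
    · ext p; simp [and_assoc]
    · ext ⟨x, X⟩
      simp only [Finset.mem_filter, Finset.mem_univ, true_and, implies_true, not_not,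
        Finset.subset_iff, mem_lowerRows]
      constructor
      · rintro ⟨h, hm, hx, z, hz, hxz⟩
        exact ⟨⟨hm, hx, z, hz, hxz⟩, h hx, ⟨z, Finset.mem_erase.mpr ⟨hxz.ne', hz⟩, hxz.le⟩,
          fun a ha => h (Finset.mem_of_mem_erase ha)⟩
      · rintro ⟨⟨hm, hx, hz⟩, hk, -, h⟩
        refine ⟨fun a ha => ?_, hm, hx, hz⟩
        by_cases hax : a = x
        · exact hax ▸ hk
        · exact h a (Finset.mem_erase.mpr ⟨hax, ha⟩)
  rw [Nat.card_sum, choose_succ_mul, choose_succ_mul]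
  omega

/-- Pairs with `x ∈ B` are counted directly; those with `x ∉ B` correspond to sets `B ∪ {x}` with a
marked element other than the maximum. -/
theorem card_injPair {k d : ℕ} (hkd : k ≤ d) (b : ℕ) :
    (Finset.univ.filter fun p : Fin d × Finset (Fin d) => ((∀ b ∈ p.2, k ≤ b.val) ∧
      k ≤ p.1.val ∧ ∃ b ∈ p.2, p.1 ≤ b) ∧ p.2.card = b).card =
      b * (d - k + 1).choose (b + 1) := by
  rw [choose_succ_mul, ← card_lowerRows hkd, ← card_filter_mem_of_card_eq,
    ← card_filter_mem_lt_of_card_eq,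
    ← Finset.card_filter_add_card_filter_not (fun p : Fin d × Finset (Fin d) => p.1 ∈ p.2),
    Finset.filter_filter, Finset.filter_filter]
  congr 1
  · congr 1
    ext ⟨x, X⟩
    simp only [Finset.mem_filter, Finset.mem_univ, true_and, Finset.subset_iff, mem_lowerRows]
    constructor
    · rintro ⟨⟨⟨h, -⟩, hb⟩, hx⟩
      exact ⟨h, hb, hx⟩
    · rintro ⟨h, hb, hx⟩
      exact ⟨⟨⟨h, h x hx, x, hx, le_rfl⟩, hb⟩, hx⟩
  · refine Finset.card_nbij' (fun p => (p.1, insert p.1 p.2)) (fun p => (p.1, p.2.erase p.1))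
      ?_ ?_ ?_ ?_
    · rintro ⟨x, X⟩ h
      simp only [Finset.coe_filter, Finset.mem_univ, true_and, Set.mem_ofPred_eq,
        Finset.subset_iff, mem_lowerRows] at h ⊢
      obtain ⟨⟨⟨h, hk, z, hz, hxz⟩, hb⟩, hx⟩ := h
      refine ⟨fun a ha => ?_, by rw [Finset.card_insert_of_notMem hx, hb], by simp, z, by simp [hz],
        lt_of_le_of_ne hxz fun e => hx (e ▸ hz)⟩
      rcases Finset.mem_insert.mp ha with rfl | ha
      · exact hk
      · exact h a ha
    · rintro ⟨x, X⟩ h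
      simp only [Finset.coe_filter, Finset.mem_univ, true_and, Set.mem_ofPred_eq,
        Finset.subset_iff, mem_lowerRows] at h ⊢
      obtain ⟨h, hb, hx, z, hz, hxz⟩ := h
      exact ⟨⟨⟨fun a ha => h (Finset.mem_of_mem_erase ha), h hx, z,
        Finset.mem_erase.mpr ⟨hxz.ne', hz⟩, hxz.le⟩,
        by rw [Finset.card_erase_of_mem hx, hb]; rfl⟩, Finset.notMem_erase x X⟩
    · rintro ⟨x, X⟩ h
      simp only [Finset.coe_filter, Finset.mem_univ, true_and, Set.mem_ofPred_eq] at h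
      simp [Finset.erase_insert h.2]
    · rintro ⟨x, X⟩ h
      simp only [Finset.coe_filter, Finset.mem_univ, true_and, Set.mem_ofPred_eq] at h
      simp [Finset.insert_erase h.2.2.1]

theorem sum_injPair {k d : ℕ} (hkd : k ≤ d) (j : ℕ) (g : ℕ → ℕ) :
    ∑ p : InjPair k d j, g p.1.2.card =
      ∑ b ∈ Finset.range j, b * (d - k + 1).choose (b + 1) * g b := by
  rw [← Finset.sum_subtype (Finset.univ.filter fun p : Fin d × Finset (Fin d) =>
      (∀ b ∈ p.2, k ≤ b.val) ∧ p.2.card < j ∧ k ≤ p.1.val ∧ ∃ b ∈ p.2, p.1 ≤ b) (by simp)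
      (fun p => g p.2.card),
    ← Finset.sum_fiberwise_of_maps_to (g := fun p => p.2.card) (t := Finset.range j)
      (fun p hp => by simpa using (Finset.mem_filter.mp hp).2.2.1)]
  refine Finset.sum_congr rfl fun b hb => ?_
  rw [Finset.sum_congr rfl (g := fun _ => g b)
      (fun p hp => by rw [(Finset.mem_filter.mp hp).2]), Finset.sum_const, smul_eq_mul,
    Finset.filter_filter, ← card_injPair hkd]
  congr 2
  ext p
  have := Finset.mem_range.mp hb
  simp only [Finset.mem_filter, Finset.mem_univ, true_and]
  constructor
  · rintro ⟨⟨h1, -, h2⟩, h3⟩; exact ⟨⟨h1, h2⟩, h3⟩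
  · rintro ⟨⟨h1, h2⟩, h3⟩; exact ⟨⟨h1, by omega, h2⟩, h3⟩

/-- A label at a code segment of a cascade is a label at the root or at a segment of the cascade
below a child. -/
def sigmaSegmentEquiv (k d : ℕ) (T : ℕ → Type) (j : ℕ) :
    (Σ Q : Segment k d j, T Q.mode) ≃
      T j ⊕ Σ p : InjPair k d j, Σ q : Segment k d (j - p.1.2.card - 1), T q.mode where
  toFun c := match c with
    | ⟨.root, t⟩ => .inl t
    | ⟨.child p q, t⟩ => .inr ⟨p, q, t⟩
  invFun c := match c with
    | .inl t => ⟨.root, t⟩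
    | .inr ⟨p, q, t⟩ => ⟨.child p q, t⟩
  left_inv := by rintro ⟨_ | _, _⟩ <;> rfl
  right_inv := by rintro (_ | ⟨_, _, _⟩) <;> rfl

theorem finite_sigma_segment (k d : ℕ) (T : ℕ → Type) [∀ m, Finite (T m)] (j : ℕ) :
    Finite (Σ Q : Segment k d j, T Q.mode) := by
  induction j using Nat.strong_induction_on with
  | _ j ih =>
  have (p : InjPair k d j) : Finite (Σ q : Segment k d (j - p.1.2.card - 1), T q.mode) :=
    ih _ (by have := p.2.2.1; omega)
  exact Finite.of_equiv _ (sigmaSegmentEquiv k d T j).symm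

theorem card_sigma_segment {k d : ℕ} (hkd : k ≤ d) (T : ℕ → Type) [∀ m, Finite (T m)] (j : ℕ) :
    Nat.card (Σ Q : Segment k d j, T Q.mode) = Nat.card (T j) +
      ∑ b ∈ Finset.range j, b * (d - k + 1).choose (b + 1) *
        Nat.card (Σ Q : Segment k d (j - b - 1), T Q.mode) := by
  have (j : ℕ) := finite_sigma_segment k d T j
  rw [Nat.card_congr (sigmaSegmentEquiv k d T j), Nat.card_sum, Nat.card_sigma,
    ← sum_injPair hkd j fun b => Nat.card (Σ Q : Segment k d (j - b - 1), T Q.mode)]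

end Counting

/-! ### The recurrence as an identity of power series -/

section GeneratingFunctions

open PowerSeries

theorem coeff_one_add_X_pow' (n m : ℕ) : coeff m ((1 + X : ℤ⟦X⟧) ^ n) = n.choose m := by
  have := Polynomial.coeff_one_add_X_pow ℤ n m
  rw [← this, ← Polynomial.coeff_coe]
  simp

/-- Coefficientwise this is `b * C(l+1, b+1) = l * C(l, b) - C(l, b+1)`, a consequence of absorption
and Pascal's rule. -/
theorem X_mul_mk_mul_choose (l : ℕ) :
    X * mk (fun b => ((b * (l + 1).choose (b + 1) : ℕ) : ℤ)) =
      1 - (1 + X) ^ l * (1 - (l : ℤ⟦X⟧) * X) := by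
  ext j
  rw [show (1 : ℤ⟦X⟧) - (1 + X) ^ l * (1 - (l : ℤ⟦X⟧) * X) =
    1 - (1 + X) ^ l + X * (C (l : ℤ) * (1 + X) ^ l) by simp; ring]
  cases j with
  | zero => simp
  | succ j =>
    simp only [map_add, map_sub, coeff_succ_X_mul, coeff_mk, coeff_C_mul, coeff_one_add_X_pow',
      coeff_one]
    have h1 := Nat.add_one_mul_choose_eq l j
    have h2 := Nat.choose_succ_succ l j
    rw [h2] at h1 ⊢
    push_cast
    zify at h1
    simp
    linarith

theorem mk_sum_mul (l : ℤ) (a : ℕ → ℤ) :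
    mk (fun j => ∑ m ∈ Finset.range (j + 1), l ^ (j - m) * a m) * (1 - C l * X) = mk a := by
  rw [mul_sub, mul_one, mul_comm, mul_assoc]
  ext j
  cases j with
  | zero => simp
  | succ j =>
    simp only [map_sub, coeff_C_mul, coeff_succ_X_mul, coeff_mk]
    rw [Finset.sum_range_succ, Finset.mul_sum, add_sub_right_comm, ← Finset.sum_sub_distrib,
      Finset.sum_eq_zero]
    · simp
    · intro m hm
      have : j + 1 - m = j - m + 1 := by have := Finset.mem_range.mp hm; omega
      rw [this]; ring

theorem mk_mul_eq_of_recurrence {l : ℕ} {S φ : ℕ → ℕ}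
    (h : ∀ j, S j = φ j +
      ∑ b ∈ Finset.range j, b * (l + 1).choose (b + 1) * S (j - b - 1)) :
    mk (fun j => (S j : ℤ)) * ((1 + X) ^ l * (1 - (l : ℤ⟦X⟧) * X)) = mk fun j => (φ j : ℤ) := by
  have key : mk (fun j => (S j : ℤ)) = mk (fun j => (φ j : ℤ)) +
      X * (mk (fun b => ((b * (l + 1).choose (b + 1) : ℕ) : ℤ)) * mk (fun j => (S j : ℤ))) := by
    ext j
    cases j with
    | zero =>
      rw [map_add, coeff_zero_X_mul, coeff_mk, coeff_mk, h 0, Finset.sum_range_zero]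
      simp
    | succ j =>
      rw [map_add, coeff_succ_X_mul, coeff_mul, Finset.Nat.sum_antidiagonal_eq_sum_range_succ_mk]
      simp only [coeff_mk]
      rw [h (j + 1)]
      push_cast
      congr 1
      refine Finset.sum_congr rfl fun b _ => ?_
      rw [show j + 1 - b - 1 = j - b by omega]
  have := X_mul_mk_mul_choose l
  linear_combination key + mk (fun j => (S j : ℤ)) * this

end GeneratingFunctions

/-! ### Evaluation of the three parameters -/

section Parameters

open PowerSeries

theorem eq_of_mk_mul_eq {l : ℕ} {f g : ℕ → ℤ}
    (h : mk f * ((1 + X) ^ l * (1 - (l : ℤ⟦X⟧) * X)) =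
      mk g * ((1 + X) ^ l * (1 - (l : ℤ⟦X⟧) * X))) : f = g := by
  have hne : (1 + X : ℤ⟦X⟧) ^ l * (1 - (l : ℤ⟦X⟧) * X) ≠ 0 := fun h0 => by
    simpa using congrArg constantCoeff h0
  have := mul_right_cancel₀ hne h
  funext j
  simpa using congrArg (coeff j) this

theorem mk_choose (n : ℕ) : mk (fun m => (n.choose m : ℤ)) = (1 + X) ^ n := by
  ext m
  rw [coeff_mk, coeff_one_add_X_pow']

theorem mk_alpha_mul (k d : ℕ) :
    mk (fun j => (alpha k d j : ℤ)) * (1 - ((d - k : ℕ) : ℤ⟦X⟧) * X) = (1 + X) ^ k := by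
  have := mk_sum_mul (d - k : ℕ) (fun m => (k.choose m : ℤ))
  rw [mk_choose] at this
  simpa [alpha] using this

theorem card_column {k d : ℕ} (hkd : k ≤ d) (j : ℕ) : Nat.card (Column k d j) = alpha k d j := by
  have hrec := mk_mul_eq_of_recurrence
    (card_sigma_segment hkd fun m => {I : Finset (Fin d) // I.card = m})
  simp only [Nat.card_eq_fintype_card (α := {I : Finset (Fin d) // _}), Fintype.card_finset_len,
    Fintype.card_fin, mk_choose] at hrec
  have h := congr_fun (eq_of_mk_mul_eq (l := d - k)
    (f := fun j => (Nat.card (Column k d j) : ℤ)) (g := fun j => (alpha k d j : ℤ)) ?_) j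
  · exact_mod_cast h
  · refine hrec.trans ?_
    have := mk_alpha_mul k d
    rw [mul_left_comm, this, ← pow_add]
    congr 1
    omega

/-- The coordinates of what a helper sends for a segment: those subsets of the right size which do
not contain `a`. -/
abbrev RepairIdx (k d j : ℕ) (a : Fin d) : Type :=
  Σ Q : Segment k d j, {J : Finset (Fin d) // J.card + 1 = Q.mode ∧ a ∉ J}

theorem card_finset_notMem {d : ℕ} (a : Fin d) (m : ℕ) :
    Nat.card {J : Finset (Fin d) // J.card + 1 = m ∧ a ∉ J} = binom (d - 1) ((m : ℤ) - 1) := by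
  rw [Nat.card_eq_fintype_card, Fintype.card_subtype]
  cases m with
  | zero => simp [binom]
  | succ m =>
    have : (Finset.univ.filter fun J : Finset (Fin d) => J.card + 1 = m + 1 ∧ a ∉ J) =
        (Finset.univ.erase a).powersetCard m := by
      ext J
      simp [Finset.mem_powersetCard, Finset.subset_erase, and_comm]
    rw [this, Finset.card_powersetCard, Finset.card_erase_of_mem (Finset.mem_univ a)]
    simp [binom]

theorem mk_binom (n : ℕ) : mk (fun m : ℕ => (binom n ((m : ℤ) - 1) : ℤ)) = X * (1 + X) ^ n := by
  ext m
  cases m with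
  | zero => simp [binom]
  | succ m => rw [coeff_succ_X_mul, coeff_one_add_X_pow', coeff_mk]; simp [binom]

theorem card_repairIdx {k d : ℕ} (hk : 1 ≤ k) (hkd : k ≤ d) (j : ℕ) (a : Fin d) :
    Nat.card (RepairIdx k d j a) = beta k d j := by
  have hrec := mk_mul_eq_of_recurrence
    (card_sigma_segment hkd fun m => {J : Finset (Fin d) // J.card + 1 = m ∧ a ∉ J})
  simp only [card_finset_notMem, mk_binom] at hrec
  have h := congr_fun (eq_of_mk_mul_eq (l := d - k)
    (f := fun j => (Nat.card (RepairIdx k d j a) : ℤ)) (g := fun j => (beta k d j : ℤ)) ?_) j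
  · exact_mod_cast h
  · refine hrec.trans ?_
    have := mk_sum_mul (d - k : ℕ) (fun m => (binom (k - 1) ((m : ℤ) - 1) : ℤ))
    rw [mk_binom] at this
    have h2 : mk (fun j => (beta k d j : ℤ)) * (1 - ((d - k : ℕ) : ℤ⟦X⟧) * X) =
        X * (1 + X) ^ (k - 1) := by simpa [beta] using this
    rw [mul_left_comm, h2, mul_left_comm, ← pow_add]
    congr 2
    omega

theorem X_mul_mk_choose_succ (n : ℕ) :
    X * mk (fun m => (n.choose (m + 1) : ℤ)) = (1 + X) ^ n - 1 := by
  ext m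
  cases m with
  | zero => simp
  | succ m => rw [coeff_succ_X_mul, map_sub, coeff_one_add_X_pow', coeff_mk]; simp [coeff_one]

/-- The file size is `k * α` minus `C(k, j+1)`; the factor `X` turns the shifted binomials into `(1
+ X) ^ k - 1`. -/
theorem X_mul_mk_fileSize_mul {k d : ℕ} (hkd : k ≤ d) :
    X * mk (fun j => fileSize k d j) * (1 - ((d - k : ℕ) : ℤ⟦X⟧) * X) =
      (k : ℤ⟦X⟧) * X * (1 + X) ^ k -
        ((1 + X) ^ k - 1) * (1 - ((d - k : ℕ) : ℤ⟦X⟧) * X) := by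
  have hF : mk (fun j => fileSize k d j) = (k : ℤ⟦X⟧) * mk (fun j => (alpha k d j : ℤ)) -
      mk (fun j => (k.choose (j + 1) : ℤ)) := by
    ext j
    rw [show (k : ℤ⟦X⟧) = C (k : ℤ) by simp, map_sub, coeff_C_mul]
    simp only [coeff_mk, fileSize, alpha]
    push_cast [Nat.cast_sub hkd]
    rw [Finset.mul_sum]
    simp only [mul_assoc]
  rw [hF]
  linear_combination ((k : ℤ⟦X⟧) * X) * mk_alpha_mul k d -
    (1 - ((d - k : ℕ) : ℤ⟦X⟧) * X) * X_mul_mk_choose_succ k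

theorem card_fileIdx {k d : ℕ} (hkd : k ≤ d) (j : ℕ) :
    (Nat.card (FileIdx k d j) : ℤ) = fileSize k d j := by
  have hrec := mk_mul_eq_of_recurrence (card_sigma_segment hkd fun m => SegIdx k d m)
  have hφ : X * mk (fun m => (Nat.card (SegIdx k d m) : ℤ)) =
      (1 - (1 + X) ^ d * (1 - (d : ℤ⟦X⟧) * X)) -
        (1 - (1 + X) ^ (d - k) * (1 - ((d - k : ℕ) : ℤ⟦X⟧) * X)) := by
    rw [← X_mul_mk_mul_choose, ← X_mul_mk_mul_choose, ← mul_sub]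
    congr 1
    ext m
    rw [map_sub, coeff_mk, coeff_mk, coeff_mk, ← card_segIdx hkd m]
    push_cast
    ring
  refine congr_fun (eq_of_mk_mul_eq (l := d - k)
    (f := fun j => (Nat.card (FileIdx k d j) : ℤ)) (g := fun j => fileSize k d j) ?_) j
  refine hrec.trans (mul_left_cancel₀ (X_ne_zero (R := ℤ)) ?_)
  have hpow : (1 + X : ℤ⟦X⟧) ^ (d - k) * (1 + X) ^ k = (1 + X) ^ d := by
    rw [← pow_add]; congr 1; omega
  have hd : (d : ℤ⟦X⟧) = ((d - k : ℕ) : ℤ⟦X⟧) + (k : ℤ⟦X⟧) := by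
    rw [← Nat.cast_add]; congr 1; omega
  rw [hφ, ← hpow, hd]
  linear_combination -(1 + X) ^ (d - k) * X_mul_mk_fileSize_mul hkd

end Parameters

/-! ### Linearity, recovery and repair of the cascade code -/

section Code

variable {𝔽 : Type*} [Field 𝔽] {k d : ℕ}

theorem detMatrix_add {m : ℕ} (σ : Fin d → ℕ) (t t' : SegIdx k d m → 𝔽) (x : Fin d)
    (I : Finset (Fin d)) :
    detMatrix σ (t + t') x I = detMatrix σ t x I + detMatrix σ t' x I := by
  have hv : ∀ X, vSym (t + t') x X = vSym t x X + vSym t' x X := fun X => by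
    unfold vSym; split_ifs <;> simp
  have hw : ∀ x Y, wRaw (t + t') x Y = wRaw t x Y + wRaw t' x Y := fun x Y => by
    unfold wRaw; split_ifs <;> simp
  unfold detMatrix wSym
  simp only [hv, hw, mul_add, Finset.sum_add_distrib]
  split_ifs <;> ring

theorem detMatrix_smul {m : ℕ} (σ : Fin d → ℕ) (c : 𝔽) (t : SegIdx k d m → 𝔽) (x : Fin d)
    (I : Finset (Fin d)) : detMatrix σ (c • t) x I = c * detMatrix σ t x I := by
  have hv : ∀ X, vSym (c • t) x X = c * vSym t x X := fun X => by
    unfold vSym; split_ifs <;> simp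
  have hw : ∀ x Y, wRaw (c • t) x Y = c * wRaw t x Y := fun x Y => by
    unfold wRaw; split_ifs <;> simp
  unfold detMatrix wSym
  simp only [hv, hw, mul_left_comm _ c, ← Finset.mul_sum]
  split_ifs <;> ring

theorem injMatrix_add (σ : Fin d → ℕ) {P P₁ P₂ : Fin d → Finset (Fin d) → 𝔽}
    (h : ∀ x I, P x I = P₁ x I + P₂ x I) (x : Fin d) (B : Finset (Fin d)) (i : Fin d)
    (I : Finset (Fin d)) :
    injMatrix σ P x B i I = injMatrix σ P₁ x B i I + injMatrix σ P₂ x B i I := by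
  unfold injMatrix
  rw [h]
  split_ifs <;> ring

theorem injMatrix_smul (σ : Fin d → ℕ) {P P₁ : Fin d → Finset (Fin d) → 𝔽} {c : 𝔽}
    (h : ∀ x I, P x I = c * P₁ x I) (x : Fin d) (B : Finset (Fin d)) (i : Fin d)
    (I : Finset (Fin d)) : injMatrix σ P x B i I = c * injMatrix σ P₁ x B i I := by
  unfold injMatrix
  rw [h]
  split_ifs <;> ring

theorem segMatrix_add {j : ℕ} (Q : Segment k d j) (σ : Fin d → ℕ)
    {Δ Δ₁ Δ₂ : Fin d → Finset (Fin d) → 𝔽} (s s' : FileIdx k d j → 𝔽)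
    (h : ∀ x I, Δ x I = Δ₁ x I + Δ₂ x I) (x : Fin d) (I : Finset (Fin d)) :
    segMatrix σ Δ (s + s') Q x I = segMatrix σ Δ₁ s Q x I + segMatrix σ Δ₂ s' Q x I := by
  induction Q generalizing σ Δ Δ₁ Δ₂ with
  | root =>
    have := detMatrix_add σ (fun t => s ⟨.root, t⟩) (fun t => s' ⟨.root, t⟩) x I
    simp only [segMatrix, h]
    linear_combination this
  | child p q ih =>
    exact ih _ _ _ (injMatrix_add σ (detMatrix_add σ _ _) _ _)

theorem segMatrix_smul {j : ℕ} (Q : Segment k d j) (σ : Fin d → ℕ) (c : 𝔽)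
    {Δ Δ₁ : Fin d → Finset (Fin d) → 𝔽} (s : FileIdx k d j → 𝔽)
    (h : ∀ x I, Δ x I = c * Δ₁ x I) (x : Fin d) (I : Finset (Fin d)) :
    segMatrix σ Δ (c • s) Q x I = c * segMatrix σ Δ₁ s Q x I := by
  induction Q generalizing σ Δ Δ₁ with
  | root =>
    have := detMatrix_smul σ c (fun t => s ⟨.root, t⟩) x I
    simp only [segMatrix, h]
    linear_combination this
  | child p q ih =>
    exact ih _ _ (injMatrix_smul σ (detMatrix_smul σ _ _) _ _)

theorem cascadeCode_apply {n : ℕ} (μ : ℕ) (Ψ : Matrix (Fin n) (Fin d) 𝔽)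
    (s : FileIdx k d μ → 𝔽) (i : Fin n) (c : Column k d μ) :
    cascadeCode μ Ψ s i c =
      ∑ x, Ψ i x * segMatrix (fun _ => 0) (fun _ _ => 0) s c.1 x c.2.1 := rfl

theorem isLinearMap_cascadeCode {n : ℕ} (μ : ℕ) (Ψ : Matrix (Fin n) (Fin d) 𝔽) :
    IsLinearMap 𝔽 (cascadeCode (k := k) μ Ψ) where
  map_add s s' := by
    ext i c
    rw [Matrix.add_apply]
    simp only [cascadeCode_apply]
    rw [← Finset.sum_add_distrib]
    refine Finset.sum_congr rfl fun x _ => ?_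
    rw [segMatrix_add c.1 _ s s' (fun _ _ => (add_zero 0).symm), mul_add]
  map_smul a s := by
    ext i c
    rw [Matrix.smul_apply, smul_eq_mul]
    simp only [cascadeCode_apply]
    rw [Finset.mul_sum]
    refine Finset.sum_congr rfl fun x _ => ?_
    rw [segMatrix_smul c.1 _ a s (fun _ _ => (mul_zero a).symm), mul_left_comm]

theorem dataRecovery_cascadeCode {n : ℕ} (μ : ℕ) {Ψ : Matrix (Fin n) (Fin d) 𝔽}
    (hΨ : IsEncoder k Ψ) (hkd : k ≤ d) : DataRecovery k (cascadeCode (k := k) μ Ψ) := by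
  intro K hK
  refine exists_linearMap_apply_eq
    (LinearMap.pi fun i : K => (LinearMap.proj (i : Fin n)).comp
      (isLinearMap_cascadeCode (k := k) μ Ψ).mk') LinearMap.id fun s hs => ?_
  refine (eq_zero_of_sum_mul_segMatrix_eq_zero hΨ hkd hK μ (fun _ => 0) (fun _ _ => 0) s
    (fun _ _ _ => rfl) (fun _ _ _ _ => rfl) fun Q I hI f hf => ?_).2
  exact congr_fun (congr_fun hs ⟨f, hf⟩) ⟨Q, I, hI⟩

/-- Extension of the part of a node's content which belongs to the segment `Q` to a function of
all finite sets. -/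
def segContent {j : ℕ} (Q : Segment k d j) (v : Column k d j → 𝔽) (I : Finset (Fin d)) : 𝔽 :=
  if h : I.card = Q.mode then v ⟨Q, I, h⟩ else 0

/-- The coordinates of the contractions of the segments of a node's content `v` by the encoder
row `ψ` of the failed node. -/
def repairMap {j : ℕ} (ψ : Fin d → 𝔽) (a : Fin d) :
    (Column k d j → 𝔽) →ₗ[𝔽] (RepairIdx k d j a → 𝔽) where
  toFun v c := contr (segSign (fun _ => 0) c.1) ψ (segContent c.1 v) c.2.1
  map_add' v w := by
    funext c
    have : ∀ I, segContent c.1 (v + w) I = segContent c.1 v I + segContent c.1 w I := fun I => by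
      unfold segContent; split_ifs <;> simp
    simp [contr, this, mul_add, Finset.sum_add_distrib]
  map_smul' r v := by
    funext c
    have : ∀ I, segContent c.1 (r • v) I = r * segContent c.1 v I := fun I => by
      unfold segContent; split_ifs <;> simp
    simp [contr, this, mul_left_comm _ r, Finset.mul_sum]

theorem exactRepair_cascadeCode {n : ℕ} (μ : ℕ) {Ψ : Matrix (Fin n) (Fin d) 𝔽}
    (hΨ : IsEncoder k Ψ) (hk : 1 ≤ k) (hkd : k ≤ d) (hdn : d < n) :
    ExactRepair d (beta k d μ) (cascadeCode (k := k) μ Ψ) := by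
  intro f
  obtain ⟨a, ha⟩ := hΨ.exists_ne_zero (by omega) hdn.le f
  have hfin := finite_sigma_segment k d (fun m => {J : Finset (Fin d) // J.card + 1 = m ∧ a ∉ J}) μ
  have e : RepairIdx k d μ a ≃ Fin (beta k d μ) :=
    Finite.equivFinOfCardEq (card_repairIdx hk hkd μ a)
  -- All helpers apply the same map, which depends on `f` alone.
  refine ⟨fun _ => (LinearEquiv.funCongrLeft 𝔽 𝔽 e.symm).toLinearMap.comp (repairMap (Ψ f) a),
    fun H _ hH => ?_⟩
  refine exists_linearMap_apply_eq
    (LinearMap.pi fun h : H => ((LinearEquiv.funCongrLeft 𝔽 𝔽 e.symm).toLinearMap.comp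
      (repairMap (Ψ f) a)).comp ((LinearMap.proj (h : Fin n)).comp
      (isLinearMap_cascadeCode (k := k) μ Ψ).mk'))
    ((LinearMap.proj f).comp (isLinearMap_cascadeCode (k := k) μ Ψ).mk') fun s hs => ?_
  have hrep : ∀ h ∈ H, repairMap (Ψ f) a (cascadeCode μ Ψ s h) = 0 := fun h hh =>
    (LinearEquiv.map_eq_zero_iff (LinearEquiv.funCongrLeft 𝔽 𝔽 e.symm)).mp
      (congr_fun hs ⟨h, hh⟩)
  have hrow : ∀ (Q : Segment k d μ) (i : Fin d) (J : Finset (Fin d)), J.card + 1 = Q.mode →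
      contr (segSign (fun _ => 0) Q) (Ψ f)
        (segMatrix (fun _ => 0) (fun _ _ => 0) s Q i) J = 0 := by
    intro Q i J hJ
    refine contr_eq_zero_of_notMem ha (fun J' hJ' haJ' => ?_) J rfl
    rw [← hJ'] at hJ
    refine hΨ.eq_zero_of_full hH (u := fun i => contr (segSign (fun _ => 0) Q) (Ψ f)
      (segMatrix (fun _ => 0) (fun _ _ => 0) s Q i) J') (fun h hh => ?_) i
    -- Contraction acts on columns and `Ψ` on rows, so they commute: contracting the content of `h`
    -- combines the contracted rows with the coefficients `Ψ h`.
    refine Eq.trans ?_ (congr_fun (hrep h hh) ⟨Q, J', hJ, haJ'⟩)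
    simp only [repairMap, LinearMap.coe_mk, AddHom.coe_mk, contr, Finset.mul_sum]
    rw [Finset.sum_comm]
    refine Finset.sum_congr rfl fun x hx => ?_
    rw [segContent, dif_pos (by
      rw [Finset.card_insert_of_notMem (Finset.mem_compl.mp hx), hJ]), cascadeCode_apply,
      Finset.mul_sum]
    exact Finset.sum_congr rfl fun y _ => mul_left_comm _ _ _
  funext c
  exact sum_mul_segMatrix_eq_zero (Ψ f) c.1 (fun _ => 0) (fun _ _ => 0) s (fun _ _ _ => rfl)
    (fun I _ => by simp [contr, paritySum]) hrow c.2.1 c.2.2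

end Code

end Cascade

theorem theorem1 (n k d μ : ℕ) (hkd : k ≤ d) (hdn : d < n) (hμ : 1 ≤ μ) (hμk : μ ≤ k)
    (𝔽 : Type*) [Field 𝔽] [Finite 𝔽] :
    (n ≤ Nat.card 𝔽 → ∃ Ψ : Matrix (Fin n) (Fin d) 𝔽, Cascade.IsEncoder k Ψ) ∧
    ∀ Ψ : Matrix (Fin n) (Fin d) 𝔽, Cascade.IsEncoder k Ψ →
      Cascade.IsLinearExactRepairCode k d
        (Cascade.alpha k d μ) (Cascade.beta k d μ) (Cascade.fileSize k d μ)
        (Cascade.cascadeCode (k := k) μ Ψ) := by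
  refine ⟨Cascade.exists_isEncoder hkd, fun Ψ hΨ => ?_⟩
  exact
    { finite_file := Cascade.finite_sigma_segment k d (fun m => Cascade.SegIdx k d m) μ
      finite_content := Cascade.finite_sigma_segment k d
        (fun m => {I : Finset (Fin d) // I.card = m}) μ
      file_size := Cascade.card_fileIdx hkd μ
      capacity := Cascade.card_column hkd μ
      linear := Cascade.isLinearMap_cascadeCode μ Ψ
      recovery := Cascade.dataRecovery_cascadeCode μ hΨ hkd
      repair := Cascade.exactRepair_cascadeCode μ hΨ (hμ.trans hμk) hkd hdn }
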